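/- Let $\mathbb{D}=\{z\in\mathbb{C}:|z|<1\}$, and let $\mathcal{A}$ be the class of functions $f$ analytic in $\mathbb{D}$ of the form $f(z)=z+a_2z^2+a_3z^3+\cdots$. Let $\mathcal{U}$ be the class of all $f\in\mathcal{A}$ such that \[ \left|\left(\frac{z}{f(z)}\right)^2 f'(z)-1\right|<1 \qquad (z\in\mathbb{D}), \] where the expression inside the modulus is given its limiting value $0$ at $z=0$, and the inequality is understood to imply that $f(z)\neq0$ for $0<|z|<1$. Then every $f(z)=z+a_2z^2+a_3z^3+\cdots$ in $\mathcal{U}$ satisfies \[ (i)\quad |a_2^2-a_3|\le 1, \qquad\qquad (ii)\quad |a_3^2-a_5|\le 4. \] Both inequalities are sharp: the Koebe function $k(z)=\dfrac{z}{(1-z)^2}$ and all its rotations $e^{-i\theta}k(e^{i\theta}z)$, $\theta\in\mathbb{R}$, belong to $\mathcal{U}$, and equality holds for them in both (i) and (ii). -/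

import Mathlib

namespace UnivalentU

/-- The open unit disc of the complex plane. -/
def unitDisc : Set ℂ := Metric.ball 0 1

/-- The `n`-th Taylor coefficient at the origin, so that an analytic `f` on the disc is
`f z = ∑ taylorCoeff f n * z ^ n`. -/
noncomputable def taylorCoeff (f : ℂ → ℂ) (n : ℕ) : ℂ :=
  iteratedDeriv n f 0 / (n.factorial : ℂ)

/-- The class `𝒜` of functions analytic in the unit disc with
`f z = z + a₂ z² + a₃ z³ + ⋯`. -/
def classA : Set (ℂ → ℂ) :=
  {f | AnalyticOnNhd ℂ f unitDisc ∧ taylorCoeff f 0 = 0 ∧ taylorCoeff f 1 = 1}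

/-- The class `𝒰` of those `f ∈ 𝒜` with `|(z / f z)² f' z - 1| < 1` on the unit disc.
The expression has a removable singularity at the origin, where its value is `0`, so only
`z ≠ 0` is a condition; at a further zero of `f` the quotient is infinite and the inequality
fails, so there must be none. -/
def classU : Set (ℂ → ℂ) :=
  {f | f ∈ classA ∧ ∀ z ∈ unitDisc, z ≠ 0 →
    f z ≠ 0 ∧ ‖(z / f z) ^ 2 * deriv f z - 1‖ < 1}

/-- The Koebe function `k z = z / (1 - z)²`. -/
noncomputable def koebe (z : ℂ) : ℂ := z / (1 - z) ^ 2

/-- The rotation `z ↦ e^{-iθ} f (e^{iθ} z)` of `f`. -/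
noncomputable def rotation (θ : ℝ) (f : ℂ → ℂ) (z : ℂ) : ℂ :=
  Complex.exp (-(θ * Complex.I)) * f (Complex.exp (θ * Complex.I) * z)

end UnivalentU

namespace UnivalentU

open Metric Set Topology ComplexConjugate

/-! Put g = z/f = 1 + b₁z + b₂z² + ⋯. The defining condition becomes |g - zg' - 1| < 1, and the
linear term of 1 - g + zg' cancels, so the Schwarz lemma applied twice gives 1 - g + zg' = z²φ with
|φ| ≤ 1. Hence (n+1)bₙ₊₂ is the n-th coefficient of φ. Inverting the series, a₂² - a₃ = b₂ = φ(0),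
which is (i), and a₃² - a₅ = b₁²b₂ - 2b₁b₃ + b₄.

For (ii), Schwarz–Pick type bounds on φ control b₃ and b₄ by 1 - |b₂|², but b₁ must also be tied to
b₂. Jack's lemma provides this: it yields g = (1 + zψ)² with |ψ| ≤ 1 (`exists_subordination`), so b₁
= 2ψ(0) and |b₂| ≥ 3|ψ(0)|² - 2. What remains is the real inequality `extremal_bound`. -/

/-! ### Schwarz, Schur and Jack lemmas. -/

/-- A function bounded by `1` on the disc and vanishing at the origin is divisible by `z`, with
quotient again bounded by `1`. -/
theorem exists_eq_mul_of_norm_le_one {h : ℂ → ℂ} (hd : DifferentiableOn ℂ h (ball 0 1))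
    (h0 : h 0 = 0) (hb : ∀ z ∈ ball (0 : ℂ) 1, ‖h z‖ ≤ 1) :
    ∃ k : ℂ → ℂ, DifferentiableOn ℂ k (ball 0 1) ∧ (∀ z ∈ ball (0 : ℂ) 1, ‖k z‖ ≤ 1) ∧
      ∀ z, h z = z * k z := by
  refine ⟨dslope h 0, ?_, ?_, ?_⟩
  · exact (Complex.differentiableOn_dslope (ball_mem_nhds 0 one_pos)).2 hd
  · intro z hz
    have := Complex.norm_dslope_le_div_of_mapsTo_ball (R₂ := 1) hd
      (by intro z hz; simpa [h0] using hb z hz) hz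
    simpa using this
  · intro z
    have := sub_smul_dslope h 0 z
    simpa [h0] using this.symm

/-- A step of the Schur algorithm. -/
theorem exists_schur_step {φ : ℂ → ℂ} (hd : DifferentiableOn ℂ φ (ball 0 1))
    (hb : ∀ z ∈ ball (0 : ℂ) 1, ‖φ z‖ ≤ 1) :
    ∃ k : ℂ → ℂ, DifferentiableOn ℂ k (ball 0 1) ∧ (∀ z ∈ ball (0 : ℂ) 1, ‖k z‖ ≤ 1) ∧
      ∀ z ∈ ball (0 : ℂ) 1, φ z - φ 0 = z * (k z * (1 - conj (φ 0) * φ z)) := by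
  rcases (hb 0 (mem_ball_self one_pos)).eq_or_lt with h1 | h1
  -- If |φ(0)| = 1, the maximum principle makes φ constant.
  · refine ⟨fun _ => 0, differentiableOn_const _, by simp, fun z hz => ?_⟩
    have := Complex.eqOn_of_isPreconnected_of_isMaxOn_norm (convex_ball (0 : ℂ) 1).isPreconnected
      isOpen_ball hd (mem_ball_self one_pos) (fun y hy => by simpa [h1] using hb y hy) hz
    simp [this]
  · have key : ∀ z ∈ ball (0 : ℂ) 1, 0 < ‖1 - conj (φ 0) * φ z‖ := by
      intro z hz
      have h2 : ‖conj (φ 0) * φ z‖ < 1 := by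
        rw [norm_mul, Complex.norm_conj]
        nlinarith [hb z hz, norm_nonneg (φ z), norm_nonneg (φ 0)]
      have h3 := norm_sub_norm_le 1 (conj (φ 0) * φ z)
      rw [norm_one] at h3
      linarith
    obtain ⟨k, hk, hkb, hke⟩ := exists_eq_mul_of_norm_le_one
      (h := fun z => (φ z - φ 0) / (1 - conj (φ 0) * φ z))
      ((hd.sub_const _).div ((hd.const_mul _).const_sub _) fun z hz => norm_pos_iff.1 (key z hz))
      (by simp) (fun z hz => by
        rw [norm_div, div_le_one (key z hz)]
        refine le_of_sq_le_sq ?_ (norm_nonneg _)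
        -- The identity showing that a disc automorphism preserves the disc.
        have e : ‖1 - conj (φ 0) * φ z‖ ^ 2 - ‖φ z - φ 0‖ ^ 2
            = (1 - ‖φ 0‖ ^ 2) * (1 - ‖φ z‖ ^ 2) := by
          simp only [Complex.sq_norm, Complex.normSq_apply, Complex.sub_re, Complex.sub_im,
            Complex.mul_re, Complex.mul_im, Complex.conj_re, Complex.conj_im, Complex.one_re,
            Complex.one_im]
          ring
        have e1 : 0 ≤ 1 - ‖φ 0‖ ^ 2 := by nlinarith [norm_nonneg (φ 0)]
        have e2 : 0 ≤ 1 - ‖φ z‖ ^ 2 := by nlinarith [norm_nonneg (φ z), hb z hz]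
        nlinarith [mul_nonneg e1 e2])
    refine ⟨k, hk, hkb, fun z hz => ?_⟩
    rw [← mul_assoc, ← hke z, div_mul_cancel₀ _ (norm_pos_iff.1 (key z hz))]

/-- **Jack's lemma** on the circle through `z₀`. -/
theorem jack {w : ℂ → ℂ} {z₀ : ℂ} (hd : DifferentiableOn ℂ w (ball 0 1)) (hz₀ : z₀ ∈ ball (0 : ℂ) 1)
    (h0 : w 0 = 0) (h1 : ‖w z₀‖ = 1) (hb : ∀ z, ‖z‖ ≤ ‖z₀‖ → ‖w z‖ ≤ 1) :
    ∃ k : ℝ, 1 ≤ k ∧ z₀ * deriv w z₀ = k * w z₀ := by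
  have hdz : HasDerivAt w (deriv w z₀) z₀ :=
    (hd.differentiableAt (isOpen_ball.mem_nhds hz₀)).hasDerivAt
  -- |w|² is maximal at z₀ along its circle, so its angular derivative, -2 times this imaginary
  -- part, vanishes.
  have hang : (conj (w z₀) * (z₀ * deriv w z₀)).im = 0 := by
    have hc : HasDerivAt (fun t : ℝ => z₀ * Complex.exp (t * Complex.I)) (z₀ * Complex.I) 0 := by
      have : HasDerivAt (fun t : ℝ => (t : ℂ) * Complex.I) Complex.I 0 := by
        simpa using (Complex.ofRealCLM.hasDerivAt (x := 0)).mul_const Complex.I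
      simpa using (this.cexp).const_mul z₀
    have hw : HasDerivAt (fun t : ℝ => w (z₀ * Complex.exp (t * Complex.I)))
        (deriv w z₀ * (z₀ * Complex.I)) 0 :=
      HasDerivAt.comp (0 : ℝ) (h₂ := w) (by simpa using hdz) hc
    have hm : IsLocalMax (fun t : ℝ => ‖w (z₀ * Complex.exp (t * Complex.I))‖ ^ 2) 0 := by
      refine Filter.Eventually.of_forall fun t => ?_
      have := hb (z₀ * Complex.exp (t * Complex.I)) (by simp [Complex.norm_exp_ofReal_mul_I])
      simp only [Complex.ofReal_zero, zero_mul, Complex.exp_zero, mul_one, h1]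
      exact pow_le_pow_left₀ (norm_nonneg _) this 2
    have h2 := hm.hasDerivAt_eq_zero hw.norm_sq
    rw [Complex.inner] at h2
    simp only [Complex.ofReal_zero, zero_mul, Complex.exp_zero, mul_one] at h2
    simp only [Complex.mul_re, Complex.mul_im, Complex.conj_re, Complex.conj_im, Complex.I_re,
      Complex.I_im] at h2 ⊢
    linarith
  have hrad : 1 ≤ (conj (w z₀) * (z₀ * deriv w z₀)).re := by
    -- Schwarz lemma for u ↦ w(uz₀). Thus |w(sz₀)|² - s² is maximal on [0, 1] at the endpoint s = 1,
    -- where its derivative is therefore nonnegative.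
    have hs : ∀ s ∈ Icc (0 : ℝ) 1, ‖w (s * z₀)‖ ≤ s := by
      intro s hs
      rcases hs.2.eq_or_lt with rfl | hs1
      · simp [h1]
      have hsm : (s : ℂ) ∈ ball (0 : ℂ) 1 := by
        simpa [abs_of_nonneg hs.1] using hs1
      have hz₀' : ‖z₀‖ < 1 := by simpa using hz₀
      have hle : ∀ u ∈ ball (0 : ℂ) 1, ‖u * z₀‖ ≤ ‖z₀‖ := by
        intro u hu
        rw [norm_mul]
        exact mul_le_of_le_one_left (norm_nonneg _) (by simpa using (mem_ball_zero_iff.1 hu).le)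
      obtain ⟨k, -, hk, e⟩ := exists_eq_mul_of_norm_le_one (h := fun u => w (u * z₀))
        (hd.comp (differentiableOn_id.mul_const _) fun u hu => by
          simpa using (hle u hu).trans_lt hz₀') (by simpa using h0) (fun u hu => hb _ (hle u hu))
      have e' := e s
      rw [e', norm_mul, Complex.norm_real, Real.norm_of_nonneg hs.1]
      exact mul_le_of_le_one_right hs.1 (hk _ hsm)
    have hc : HasDerivAt (fun s : ℝ => (s : ℂ) * z₀) z₀ 1 := by
      simpa using (Complex.ofRealCLM.hasDerivAt (x := 1)).mul_const z₀
    have hw : HasDerivAt (fun s : ℝ => w (s * z₀)) (deriv w z₀ * z₀) 1 :=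
      HasDerivAt.comp (1 : ℝ) (h₂ := w) (by simpa using hdz) hc
    have hG := hw.norm_sq.sub ((hasDerivAt_id (1 : ℝ)).pow 2)
    have hm : IsLocalMaxOn ((fun s : ℝ => ‖w (s * z₀)‖ ^ 2) - id ^ 2) (Icc 0 1) 1 := by
      refine Filter.eventually_of_mem self_mem_nhdsWithin fun s hsI => ?_
      have := pow_le_pow_left₀ (norm_nonneg _) (hs s hsI) 2
      simp [h1]
      linarith
    have h2 := hm.hasFDerivWithinAt_nonpos hG.hasFDerivAt.hasFDerivWithinAt (y := 0 - 1)
      (sub_mem_posTangentConeAt_of_segment_subset (by rw [segment_symm, segment_eq_Icc zero_le_one]))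
    rw [Complex.inner] at h2
    simp at h2 ⊢
    linarith
  refine ⟨_, hrad, ?_⟩
  have hc : ((conj (w z₀) * (z₀ * deriv w z₀)).re : ℂ) = conj (w z₀) * (z₀ * deriv w z₀) := by
    apply Complex.ext <;> simp [-Complex.mul_re, -Complex.mul_im, hang]
  have hn : conj (w z₀) * w z₀ = 1 := by
    rw [mul_comm, Complex.mul_conj, Complex.normSq_eq_norm_sq, h1]; simp
  rw [hc]
  linear_combination -(z₀ * deriv w z₀) * hn

/-! ### Subordination of z/f to (1 + z)². -/

/-- A nonvanishing holomorphic function on the disc has a holomorphic square root. -/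
theorem exists_sq_eq {g : ℂ → ℂ} (hd : DifferentiableOn ℂ g (ball 0 1))
    (h0 : g 0 = 1) (hn : ∀ z ∈ ball (0 : ℂ) 1, g z ≠ 0) :
    ∃ s : ℂ → ℂ, DifferentiableOn ℂ s (ball 0 1) ∧ s 0 = 1 ∧
      ∀ z ∈ ball (0 : ℂ) 1, g z = s z ^ 2 := by
  -- L is a logarithm of g: a primitive of g'/g with L(0) = 0. The root is exp(L/2).
  obtain ⟨L, hL0, hL⟩ := ((hd.deriv isOpen_ball).div hd hn).isExactOn_ball.with_val_at 0 0
  have hLd : DifferentiableOn ℂ L (ball 0 1) :=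
    fun z hz => (hL z hz).differentiableAt.differentiableWithinAt
  refine ⟨fun z => Complex.exp (L z / 2), (hLd.div_const 2).cexp, by simp [hL0], ?_⟩
  have hder : ∀ z ∈ ball (0 : ℂ) 1, HasDerivAt (fun z => g z * Complex.exp (-L z)) 0 z := by
    intro z hz
    have := (hd.differentiableAt (isOpen_ball.mem_nhds hz)).hasDerivAt.mul (hL z hz).neg.cexp
    refine this.congr_deriv ?_
    have := hn z hz
    simp only [Pi.div_apply]
    field_simp
    ring
  intro z hz
  have hcst : g z * Complex.exp (-L z) = g 0 * Complex.exp (-L 0) :=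
    isOpen_ball.is_const_of_deriv_eq_zero (convex_ball (0 : ℂ) 1).isPreconnected
      (fun z hz => (hder z hz).differentiableAt.differentiableWithinAt)
      (fun z hz => (hder z hz).deriv) hz (mem_ball_self one_pos)
  rw [h0, hL0, neg_zero, Complex.exp_zero, mul_one, Complex.exp_neg] at hcst
  rw [← Complex.exp_nat_mul]
  have := Complex.exp_ne_zero (L z)
  field_simp at hcst
  rw [hcst]
  congr 1
  push_cast
  ring

/-- A continuous function on the disc that vanishes at the origin either is bounded by `1` or has
a point where its modulus reaches `1` for the first time. -/
theorem exists_first_norm_eq_one {w : ℂ → ℂ} (hc : ContinuousOn w (ball 0 1)) (h0 : w 0 = 0)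
    {z₁ : ℂ} (hz₁ : z₁ ∈ ball (0 : ℂ) 1) (hw : 1 ≤ ‖w z₁‖) :
    ∃ z₀ ∈ ball (0 : ℂ) 1, ‖w z₀‖ = 1 ∧ ∀ z, ‖z‖ ≤ ‖z₀‖ → ‖w z‖ ≤ 1 := by
  have hsub : closedBall (0 : ℂ) ‖z₁‖ ⊆ ball 0 1 := closedBall_subset_ball (by simpa using hz₁)
  have hcl := (hc.mono hsub).norm.preimage_isClosed_of_isClosed isClosed_closedBall
    (isClosed_Ici (a := (1 : ℝ)))
  obtain ⟨z₀, hz₀, hmin⟩ := ((isCompact_closedBall (0 : ℂ) ‖z₁‖).of_isClosed_subset hcl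
    inter_subset_left).exists_isMinOn ⟨z₁, by simp, hw⟩ continuous_norm.continuousOn
  have hlt : ∀ z, ‖z‖ < ‖z₀‖ → ‖w z‖ < 1 := by
    intro z hz
    by_contra! h
    have hz₀1 : ‖z₀‖ ≤ ‖z₁‖ := by simpa using hz₀.1
    exact absurd (hmin (show z ∈ _ from ⟨by simpa using hz.le.trans hz₀1, h⟩)) (by simpa using hz)
  -- Needed below: a ball of radius 0 is empty, so its closure is not the closed ball.
  have hz₀n : z₀ ≠ 0 := by
    rintro rfl
    have : (1 : ℝ) ≤ ‖w 0‖ := hz₀.2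
    rw [h0, norm_zero] at this
    linarith
  have hle : ∀ z, ‖z‖ ≤ ‖z₀‖ → ‖w z‖ ≤ 1 := by
    have hcl' : closure (ball (0 : ℂ) ‖z₀‖) = closedBall 0 ‖z₀‖ :=
      closure_ball 0 (norm_ne_zero_iff.2 hz₀n)
    have hsub' : closedBall (0 : ℂ) ‖z₀‖ ⊆ ball 0 1 := closedBall_subset_ball (by
      simpa using hsub hz₀.1)
    intro z hz
    refine le_on_closure (s := ball (0 : ℂ) ‖z₀‖) (f := fun z => ‖w z‖) (g := fun _ => (1 : ℝ))
      (fun y hy => (hlt y (by simpa using hy)).le) ?_ continuousOn_const ?_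
    · rw [hcl']; exact (hc.mono hsub').norm
    · rw [hcl']; simpa using hz
  exact ⟨z₀, hsub hz₀.1, le_antisymm (hle z₀ le_rfl) hz₀.2, hle⟩

/-- The subordination `g ≺ (1 + z) ^ 2` for the functions `g = z / f`, `f ∈ 𝒰`. -/
theorem exists_subordination {g : ℂ → ℂ} (hd : DifferentiableOn ℂ g (ball 0 1))
    (h0 : g 0 = 1) (hn : ∀ z ∈ ball (0 : ℂ) 1, g z ≠ 0)
    (hU : ∀ z ∈ ball (0 : ℂ) 1, ‖g z - z * deriv g z - 1‖ < 1) :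
    ∃ w : ℂ → ℂ, DifferentiableOn ℂ w (ball 0 1) ∧ w 0 = 0 ∧
      (∀ z ∈ ball (0 : ℂ) 1, ‖w z‖ ≤ 1) ∧ ∀ z ∈ ball (0 : ℂ) 1, g z = (1 + w z) ^ 2 := by
  obtain ⟨s, hs, hs0, hsg⟩ := exists_sq_eq hd h0 hn
  have hw : DifferentiableOn ℂ (fun z => s z - 1) (ball 0 1) := hs.sub_const 1
  refine ⟨fun z => s z - 1, hw, by simp [hs0], ?_, fun z hz => by simp [hsg z hz]⟩
  intro z₁ hz₁
  by_contra! h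
  obtain ⟨z₀, hz₀, hz1, hle⟩ :=
    exists_first_norm_eq_one hw.continuousOn (by simp [hs0]) hz₁ h.le
  obtain ⟨k, hk, hke⟩ := jack hw hz₀ (by simp [hs0]) hz1 hle
  have hsd : HasDerivAt s (deriv s z₀) z₀ :=
    (hs.differentiableAt (isOpen_ball.mem_nhds hz₀)).hasDerivAt
  have hg : deriv g z₀ = 2 * s z₀ * deriv s z₀ := by
    have e : g =ᶠ[𝓝 z₀] fun z => s z ^ 2 :=
      Filter.eventually_of_mem (isOpen_ball.mem_nhds hz₀) hsg
    rw [e.deriv_eq]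
    simpa using (hsd.fun_pow 2).deriv
  have h2 := hU z₀ hz₀
  rw [deriv_sub_const] at hke
  set W := s z₀ - 1 with hW
  -- With |W| = 1 and k ≥ 1 the modulus is at least (2k - 1) - (2k - 2) = 1, contradicting the
  -- strict bound.
  have e : g z₀ - z₀ * deriv g z₀ - 1 = -(W * ((2 * k - 1 : ℝ) * W + (2 * k - 2 : ℝ))) := by
    rw [hg, hsg z₀ hz₀]
    push_cast
    linear_combination (-2 * s z₀) * hke
  rw [e, norm_neg, norm_mul, hz1, one_mul] at h2
  have h3 := norm_sub_le (((2 * k - 1 : ℝ) : ℂ) * W + (2 * k - 2 : ℝ)) ((2 * k - 2 : ℝ) : ℂ)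
  rw [add_sub_cancel_right, norm_mul, hz1, Complex.norm_real, Complex.norm_real,
    Real.norm_of_nonneg (by linarith), Real.norm_of_nonneg (by linarith)] at h3
  linarith

/-! ### Calculus of Taylor coefficients. -/

theorem taylorCoeff_congr {f g : ℂ → ℂ} (h : EqOn f g (ball 0 1)) (n : ℕ) :
    taylorCoeff f n = taylorCoeff g n := by
  have e : f =ᶠ[𝓝 0] g := Filter.eventually_of_mem (ball_mem_nhds 0 one_pos) h
  rw [taylorCoeff, taylorCoeff, e.iteratedDeriv_eq]

theorem contDiffAt_zero_of_differentiableOn {f : ℂ → ℂ} (hf : DifferentiableOn ℂ f (ball 0 1))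
    {n : WithTop ℕ∞} : ContDiffAt ℂ n f 0 :=
  (hf.analyticAt (ball_mem_nhds 0 one_pos)).contDiffAt

theorem taylorCoeff_mul {f g : ℂ → ℂ} (hf : DifferentiableOn ℂ f (ball 0 1))
    (hg : DifferentiableOn ℂ g (ball 0 1)) (n : ℕ) :
    taylorCoeff (fun z => f z * g z) n =
      ∑ i ∈ Finset.range (n + 1), taylorCoeff f i * taylorCoeff g (n - i) := by
  rw [taylorCoeff, iteratedDeriv_fun_mul (contDiffAt_zero_of_differentiableOn hf)
    (contDiffAt_zero_of_differentiableOn hg), Finset.sum_div]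
  refine Finset.sum_congr rfl fun i hi => ?_
  have hi' : i ≤ n := by simpa [Nat.lt_succ_iff] using hi
  rw [taylorCoeff, taylorCoeff, Nat.cast_choose ℂ hi']
  have h1 : (n.factorial : ℂ) ≠ 0 := by exact_mod_cast n.factorial_ne_zero
  field_simp

theorem taylorCoeff_zero (f : ℂ → ℂ) : taylorCoeff f 0 = f 0 := by simp [taylorCoeff]

theorem taylorCoeff_const_succ (c : ℂ) (n : ℕ) : taylorCoeff (fun _ => c) (n + 1) = 0 := by
  simp [taylorCoeff, iteratedDeriv_const]

theorem taylorCoeff_id (n : ℕ) : taylorCoeff (fun z => z) n = if n = 1 then 1 else 0 := by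
  rcases n with _ | _ | n
  · simp [taylorCoeff]
  · simp [taylorCoeff]
  · simp [taylorCoeff, iteratedDeriv_succ', iteratedDeriv_const]

theorem taylorCoeff_add {f g : ℂ → ℂ} (hf : DifferentiableOn ℂ f (ball 0 1))
    (hg : DifferentiableOn ℂ g (ball 0 1)) (n : ℕ) :
    taylorCoeff (fun z => f z + g z) n = taylorCoeff f n + taylorCoeff g n := by
  rw [taylorCoeff, iteratedDeriv_fun_add (contDiffAt_zero_of_differentiableOn hf)
    (contDiffAt_zero_of_differentiableOn hg), add_div, taylorCoeff, taylorCoeff]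

theorem taylorCoeff_sub {f g : ℂ → ℂ} (hf : DifferentiableOn ℂ f (ball 0 1))
    (hg : DifferentiableOn ℂ g (ball 0 1)) (n : ℕ) :
    taylorCoeff (fun z => f z - g z) n = taylorCoeff f n - taylorCoeff g n := by
  rw [taylorCoeff, iteratedDeriv_fun_sub (contDiffAt_zero_of_differentiableOn hf)
    (contDiffAt_zero_of_differentiableOn hg), sub_div, taylorCoeff, taylorCoeff]

theorem taylorCoeff_deriv (f : ℂ → ℂ) (n : ℕ) :
    taylorCoeff (deriv f) n = (n + 1) * taylorCoeff f (n + 1) := by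
  rw [taylorCoeff, taylorCoeff, iteratedDeriv_succ', Nat.factorial_succ]
  have := Nat.factorial_ne_zero n
  have : (n : ℂ) + 1 ≠ 0 := by exact_mod_cast n.succ_ne_zero
  push_cast
  field_simp

theorem taylorCoeff_id_mul_succ {f : ℂ → ℂ} (hf : DifferentiableOn ℂ f (ball 0 1)) (n : ℕ) :
    taylorCoeff (fun z => z * f z) (n + 1) = taylorCoeff f n := by
  rw [taylorCoeff_mul differentiable_fun_id.differentiableOn hf, Finset.sum_eq_single 1]
  · simp [taylorCoeff_id]
  · intro i _ hi; simp [taylorCoeff_id, hi]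
  · simp

/-! ### Coefficient bounds for bounded functions. -/

/-- The coefficients `c₁`, `c₂` of a function bounded by `1` in terms of its Schur parameters. -/
theorem exists_schur_coeff {φ : ℂ → ℂ} (hd : DifferentiableOn ℂ φ (ball 0 1))
    (hb : ∀ z ∈ ball (0 : ℂ) 1, ‖φ z‖ ≤ 1) :
    ∃ k : ℂ → ℂ, DifferentiableOn ℂ k (ball 0 1) ∧ (∀ z ∈ ball (0 : ℂ) 1, ‖k z‖ ≤ 1) ∧
      taylorCoeff φ 1 = k 0 * (1 - ‖φ 0‖ ^ 2 : ℝ) ∧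
      taylorCoeff φ 2 = taylorCoeff k 1 * (1 - ‖φ 0‖ ^ 2 : ℝ)
        - k 0 * conj (φ 0) * taylorCoeff φ 1 := by
  obtain ⟨k, hk, hkb, hke⟩ := exists_schur_step hd hb
  have hn : (1 - ‖φ 0‖ ^ 2 : ℝ) = 1 - conj (φ 0) * φ 0 := by
    rw [mul_comm, Complex.mul_conj, Complex.normSq_eq_norm_sq]; push_cast; rfl
  have hm : DifferentiableOn ℂ (fun z => conj (φ 0) * φ z) (ball 0 1) := hd.const_mul _
  have h1 : DifferentiableOn ℂ (fun z => 1 - conj (φ 0) * φ z) (ball 0 1) := hm.const_sub 1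
  have key : ∀ n, taylorCoeff φ (n + 1) =
      ∑ i ∈ Finset.range (n + 1), taylorCoeff k i *
        (taylorCoeff (fun _ => 1) (n - i)
          - taylorCoeff (fun z => conj (φ 0) * φ z) (n - i)) := by
    intro n
    have := taylorCoeff_congr hke (n + 1)
    rw [taylorCoeff_sub hd (differentiableOn_const _), taylorCoeff_const_succ, sub_zero,
      taylorCoeff_id_mul_succ (hk.fun_mul h1), taylorCoeff_mul hk h1] at this
    rw [this]
    simp_rw [taylorCoeff_sub (differentiableOn_const (1 : ℂ)) hm]
  refine ⟨k, hk, hkb, ?_, ?_⟩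
  · rw [key 0, hn]
    simp [taylorCoeff_zero]
  · have e : taylorCoeff (fun z => conj (φ 0) * φ z) 1 = conj (φ 0) * taylorCoeff φ 1 := by
      rw [taylorCoeff_mul (differentiableOn_const _) hd]
      simp [Finset.sum_range_succ, taylorCoeff_const_succ _ 0, taylorCoeff_zero]
    rw [key 1, hn]
    simp [Finset.sum_range_succ, taylorCoeff_zero, e, taylorCoeff_const_succ _ 0]
    ring

theorem norm_taylorCoeff_one_le {φ : ℂ → ℂ} (hd : DifferentiableOn ℂ φ (ball 0 1))
    (hb : ∀ z ∈ ball (0 : ℂ) 1, ‖φ z‖ ≤ 1) : ‖taylorCoeff φ 1‖ ≤ 1 - ‖φ 0‖ ^ 2 := by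
  obtain ⟨k, -, hkb, h, -⟩ := exists_schur_coeff hd hb
  have h0 := hb 0 (mem_ball_self one_pos)
  have h1 : 0 ≤ 1 - ‖φ 0‖ ^ 2 := by nlinarith [norm_nonneg (φ 0)]
  rw [h, norm_mul, Complex.norm_real, Real.norm_of_nonneg h1]
  exact mul_le_of_le_one_left h1 (hkb 0 (mem_ball_self one_pos))

/-- The Schur step factors the coefficient as (k₁ - k₀² · conj φ(0))(1 - |φ(0)|²), and |k₁| ≤ 1 -
|k₀|² bounds the first factor by 1. -/
theorem norm_taylorCoeff_two_le {φ : ℂ → ℂ} (hd : DifferentiableOn ℂ φ (ball 0 1))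
    (hb : ∀ z ∈ ball (0 : ℂ) 1, ‖φ z‖ ≤ 1) : ‖taylorCoeff φ 2‖ ≤ 1 - ‖φ 0‖ ^ 2 := by
  obtain ⟨k, hk, hkb, h1, h2⟩ := exists_schur_coeff hd hb
  have h0 := hb 0 (mem_ball_self one_pos)
  have hp : 0 ≤ 1 - ‖φ 0‖ ^ 2 := by nlinarith [norm_nonneg (φ 0)]
  have e : taylorCoeff φ 2 = (taylorCoeff k 1 - k 0 ^ 2 * conj (φ 0)) * (1 - ‖φ 0‖ ^ 2 : ℝ) := by
    rw [h2, h1]; ring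
  rw [e, norm_mul, Complex.norm_real, Real.norm_of_nonneg hp]
  refine mul_le_of_le_one_left hp ?_
  have h3 := norm_sub_le (taylorCoeff k 1) (k 0 ^ 2 * conj (φ 0))
  rw [norm_mul, norm_pow, Complex.norm_conj] at h3
  have h4 := norm_taylorCoeff_one_le hk hkb
  nlinarith [mul_le_of_le_one_right (sq_nonneg ‖k 0‖) h0]

/-! ### The two coefficient inequalities. -/

/-- The extremal problem in `t = |b₁| / 2` and `x = |b₂|`. -/
theorem extremal_bound {t x : ℝ} (hx0 : 0 ≤ x) (hx1 : x ≤ 1)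
    (h : 3 * t ^ 2 - 2 ≤ x) :
    4 * t ^ 2 * x + 2 * t * (1 - x ^ 2) + (1 - x ^ 2) / 3 ≤ 4 := by
  have h1 : 0 ≤ 1 - x ^ 2 := by nlinarith
  -- Replace 2t by 1 + t², then t² by its bound (x + 2)/3; the deficit left is (1 - x)(6 - 3x -
  -- x²)/3.
  have h2 : 0 ≤ (1 - t) ^ 2 * (1 - x ^ 2) := mul_nonneg (sq_nonneg _) h1
  have h3 : 0 ≤ (x + 2 - 3 * t ^ 2) * (4 * x + 1 - x ^ 2) :=
    mul_nonneg (by linarith) (by linarith)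
  have h4 : 0 ≤ (1 - x) * (6 - 3 * x - x ^ 2) := mul_nonneg (by linarith) (by nlinarith)
  nlinarith

/-- The data attached to `f ∈ 𝒰`: the function `g = z / f`, the Schwarz function `z ψ` with
`g = (1 + z ψ) ^ 2`, and the bounded function `φ` with `1 - g + z g' = z ^ 2 φ`. -/
theorem exists_of_mem_classU {f : ℂ → ℂ} (hf : f ∈ classU) :
    ∃ F g ψ φ : ℂ → ℂ, (DifferentiableOn ℂ F (ball 0 1) ∧ DifferentiableOn ℂ g (ball 0 1) ∧
        DifferentiableOn ℂ ψ (ball 0 1) ∧ DifferentiableOn ℂ φ (ball 0 1)) ∧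
      ((∀ z ∈ ball (0 : ℂ) 1, ‖ψ z‖ ≤ 1) ∧ (∀ z ∈ ball (0 : ℂ) 1, ‖φ z‖ ≤ 1)) ∧
      EqOn f (fun z => z * F z) (ball 0 1) ∧ EqOn (fun z => F z * g z) (fun _ => 1) (ball 0 1) ∧
      EqOn g (fun z => (1 + z * ψ z) * (1 + z * ψ z)) (ball 0 1) ∧
      EqOn (fun z => 1 - g z + z * deriv g z) (fun z => z * (z * φ z)) (ball 0 1) := by
  obtain ⟨⟨hfa, hf0, hf1⟩, hfU⟩ := hf
  rw [taylorCoeff_zero] at hf0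
  have hf1' : deriv f 0 = 1 := by simpa [taylorCoeff] using hf1
  have hfd : DifferentiableOn ℂ f (ball 0 1) := hfa.differentiableOn
  set F := dslope f 0 with hF
  have hFd : DifferentiableOn ℂ F (ball 0 1) :=
    (Complex.differentiableOn_dslope (ball_mem_nhds 0 one_pos)).2 hfd
  have hfF : ∀ z, f z = z * F z := fun z => by simpa [hf0] using (sub_smul_dslope f 0 z).symm
  have hF0 : F 0 = 1 := by simp [hF, hf1']
  have hFn : ∀ z ∈ ball (0 : ℂ) 1, F z ≠ 0 := by
    intro z hz h
    rcases eq_or_ne z 0 with rfl | h0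
    · simp [hF0] at h
    · exact (hfU z hz h0).1 (by rw [hfF, h, mul_zero])
  have hgd : DifferentiableOn ℂ (fun z => (F z)⁻¹) (ball 0 1) := hFd.inv hFn
  have hgU : ∀ z ∈ ball (0 : ℂ) 1, ‖(F z)⁻¹ - z * deriv (fun z => (F z)⁻¹) z - 1‖ < 1 := by
    intro z hz
    rcases eq_or_ne z 0 with rfl | h0
    · simp [hF0]
    have hFz := (hFd.differentiableAt (isOpen_ball.mem_nhds hz)).hasDerivAt
    have hd : deriv f z = 1 * F z + z * deriv F z := by
      rw [show f = fun z => z * F z from funext hfF]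
      exact ((hasDerivAt_id' z).fun_mul hFz).deriv
    convert (hfU z hz h0).2 using 2
    have h1 := hFn z hz
    rw [(hFz.fun_inv h1).deriv, hd, hfF z]
    field_simp
    ring
  obtain ⟨w, hw, hw0, hwb, hgw⟩ := exists_subordination hgd (by simp [hF0])
    (fun z hz => inv_ne_zero (hFn z hz)) hgU
  obtain ⟨ψ, hψ, hψb, hwψ⟩ := exists_eq_mul_of_norm_le_one hw hw0 hwb
  have hpd : DifferentiableOn ℂ (fun z => 1 - (F z)⁻¹ + z * deriv (fun z => (F z)⁻¹) z)
      (ball 0 1) :=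
    (hgd.const_sub 1).fun_add (differentiable_fun_id.differentiableOn.fun_mul (hgd.deriv isOpen_ball))
  obtain ⟨p, hp, hpb, hpe⟩ := exists_eq_mul_of_norm_le_one hpd (by simp [hF0]) (fun z hz => by
    rw [show 1 - (F z)⁻¹ + z * deriv (fun z => (F z)⁻¹) z
      = -((F z)⁻¹ - z * deriv (fun z => (F z)⁻¹) z - 1) by ring, norm_neg]
    exact (hgU z hz).le)
  -- The coefficient of z in 1 - g + zg' is -b₁ + b₁, which allows a second division by z.
  have hp0 : p 0 = 0 := by
    rw [← taylorCoeff_zero p, ← taylorCoeff_id_mul_succ hp, ← taylorCoeff_congr fun z _ => hpe z,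
      taylorCoeff_add (hgd.const_sub 1) (differentiable_fun_id.differentiableOn.fun_mul (hgd.deriv isOpen_ball)),
      taylorCoeff_sub (differentiableOn_const _) hgd, taylorCoeff_const_succ,
      taylorCoeff_id_mul_succ (hgd.deriv isOpen_ball), taylorCoeff_deriv]
    simp
  obtain ⟨φ, hφ, hφb, hφe⟩ := exists_eq_mul_of_norm_le_one hp hp0 hpb
  refine ⟨F, fun z => (F z)⁻¹, ψ, φ, ⟨hFd, hgd, hψ, hφ⟩, ⟨hψb, hφb⟩, fun z _ => hfF z,
    fun z hz => mul_inv_cancel₀ (hFn z hz), fun z hz => ?_, fun z _ => ?_⟩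
  · change (F z)⁻¹ = _
    rw [hgw z hz, hwψ z, sq]
  · change _ = z * (z * φ z)
    rw [← hφe z]
    exact hpe z

/-- The coefficients of `f ∈ 𝒰` in terms of those of `φ`, and the relation between `φ` and `ψ`. -/
theorem exists_coeff_of_mem_classU {f : ℂ → ℂ} (hf : f ∈ classU) :
    ∃ φ ψ : ℂ → ℂ, (DifferentiableOn ℂ φ (ball 0 1) ∧ DifferentiableOn ℂ ψ (ball 0 1)) ∧
      ((∀ z ∈ ball (0 : ℂ) 1, ‖φ z‖ ≤ 1) ∧ (∀ z ∈ ball (0 : ℂ) 1, ‖ψ z‖ ≤ 1)) ∧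
      φ 0 = 2 * taylorCoeff ψ 1 + ψ 0 ^ 2 ∧
      taylorCoeff f 2 ^ 2 - taylorCoeff f 3 = φ 0 ∧
      taylorCoeff f 3 ^ 2 - taylorCoeff f 5 =
        4 * ψ 0 ^ 2 * φ 0 - 2 * ψ 0 * taylorCoeff φ 1 + taylorCoeff φ 2 / 3 := by
  obtain ⟨F, g, ψ, φ, ⟨hF, hg, hψ, hφ⟩, ⟨hψb, hφb⟩, efF, eFg, egψ, egφ⟩ := exists_of_mem_classU hf
  have hgd := hg.deriv isOpen_ball
  have hzg : DifferentiableOn ℂ (fun z => z * deriv g z) (ball 0 1) :=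
    differentiable_fun_id.differentiableOn.fun_mul hgd
  have hzφ : DifferentiableOn ℂ (fun z => z * φ z) (ball 0 1) := differentiable_fun_id.differentiableOn.fun_mul hφ
  have hzψ : DifferentiableOn ℂ (fun z => z * ψ z) (ball 0 1) := differentiable_fun_id.differentiableOn.fun_mul hψ
  have h1ψ : DifferentiableOn ℂ (fun z => 1 + z * ψ z) (ball 0 1) := hzψ.const_add 1
  have hfF : ∀ n, taylorCoeff f (n + 1) = taylorCoeff F n := fun n => by
    rw [taylorCoeff_congr efF, taylorCoeff_id_mul_succ hF]
  have hFg : ∀ n, ∑ i ∈ Finset.range (n + 1), taylorCoeff F i * taylorCoeff g (n - i)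
      = taylorCoeff (fun _ => 1) n := fun n => by
    rw [← taylorCoeff_mul hF hg, taylorCoeff_congr eFg]
  have hgφ : ∀ n : ℕ, (n + 1) * taylorCoeff g (n + 2) = taylorCoeff φ n := fun n => by
    have := taylorCoeff_congr egφ (n + 2)
    rw [taylorCoeff_id_mul_succ hzφ, taylorCoeff_id_mul_succ hφ,
      taylorCoeff_add (hg.const_sub 1) hzg, taylorCoeff_sub (differentiableOn_const _) hg,
      taylorCoeff_const_succ, taylorCoeff_id_mul_succ hgd, taylorCoeff_deriv] at this
    rw [← this]
    push_cast
    ring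
  have h1 : ∀ n, taylorCoeff (fun z => 1 + z * ψ z) (n + 1) = taylorCoeff ψ n := fun n => by
    rw [taylorCoeff_add (differentiableOn_const _) hzψ, taylorCoeff_const_succ,
      taylorCoeff_id_mul_succ hψ, zero_add]
  have h10 : taylorCoeff (fun z => 1 + z * ψ z) 0 = 1 := by simp [taylorCoeff_zero]
  have hgψ := fun n => (taylorCoeff_congr egψ n).trans (taylorCoeff_mul h1ψ h1ψ n)
  have g0 := hgψ 0
  have g1 := hgψ 1
  have g2 := hgψ 2
  have F0 := hFg 0
  have F1 := hFg 1
  have F2 := hFg 2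
  have F3 := hFg 3
  have F4 := hFg 4
  have φ0 := hgφ 0
  have φ1 := hgφ 1
  have φ2 := hgφ 2
  have h11 := h1 0
  have h12 := h1 1
  simp only [Finset.sum_range_succ, Finset.sum_range_zero, zero_add, Nat.sub_zero, Nat.sub_self,
    Nat.reduceSub, h10, h11, h12, Nat.reduceAdd] at g0 g1 g2 F0 F1 F2 F3 F4 φ0 φ1 φ2 h11 h12
  rw [taylorCoeff_const_succ _ 0] at F1
  rw [taylorCoeff_const_succ _ 1] at F2
  rw [taylorCoeff_const_succ _ 2] at F3
  rw [taylorCoeff_const_succ _ 3] at F4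
  rw [taylorCoeff_zero (fun _ => (1 : ℂ))] at F0
  norm_num at g0 φ0 φ1 φ2
  rw [g0] at F0 F1 F2 F3 F4
  rw [mul_one] at F0
  rw [F0] at F1 F2 F3 F4
  have a2 : taylorCoeff F 1 = -taylorCoeff g 1 := by linear_combination F1
  have a3 : taylorCoeff F 2 = taylorCoeff g 1 ^ 2 - taylorCoeff g 2 := by
    rw [a2] at F2; linear_combination F2
  have a4 : taylorCoeff F 3 = -taylorCoeff g 1 ^ 3 + 2 * taylorCoeff g 1 * taylorCoeff g 2
      - taylorCoeff g 3 := by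
    rw [a2, a3] at F3; linear_combination F3
  have a5 : taylorCoeff F 4 = taylorCoeff g 1 ^ 4 - 3 * taylorCoeff g 1 ^ 2 * taylorCoeff g 2
      + taylorCoeff g 2 ^ 2 + 2 * taylorCoeff g 1 * taylorCoeff g 3 - taylorCoeff g 4 := by
    rw [a2, a3, a4] at F4; linear_combination F4
  rw [taylorCoeff_zero] at φ0
  rw [taylorCoeff_zero] at g1 g2
  refine ⟨φ, ψ, ⟨hφ, hψ⟩, ⟨hφb, hψb⟩, ?_, ?_, ?_⟩
  · rw [← φ0, g2]; ring
  · rw [hfF 1, hfF 2, a2, a3, ← φ0]; ring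
  · rw [hfF 2, hfF 4, a3, a5, ← φ0, ← φ1, ← φ2, g1]; ring

theorem norm_coeff_le_of_mem_classU {f : ℂ → ℂ} (hf : f ∈ classU) :
    ‖taylorCoeff f 2 ^ 2 - taylorCoeff f 3‖ ≤ 1 ∧ ‖taylorCoeff f 3 ^ 2 - taylorCoeff f 5‖ ≤ 4 := by
  obtain ⟨φ, ψ, ⟨hφ, hψ⟩, ⟨hφb, hψb⟩, e, e3, e5⟩ := exists_coeff_of_mem_classU hf
  have hφ0 := hφb 0 (mem_ball_self one_pos)
  refine ⟨e3 ▸ hφ0, ?_⟩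
  have h1 := norm_taylorCoeff_one_le hφ hφb
  have h2 := norm_taylorCoeff_two_le hφ hφb
  have h3 := norm_taylorCoeff_one_le hψ hψb
  -- From φ(0) = 2ψ₁ + ψ(0)² and |ψ₁| ≤ 1 - |ψ(0)|².
  have h4 : 3 * ‖ψ 0‖ ^ 2 - 2 ≤ ‖φ 0‖ := by
    have := norm_sub_le (φ 0) (2 * taylorCoeff ψ 1)
    rw [show φ 0 - 2 * taylorCoeff ψ 1 = ψ 0 ^ 2 by rw [e]; ring, norm_pow, norm_mul,
      Complex.norm_ofNat] at this
    linarith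
  refine le_trans ?_ (extremal_bound (norm_nonneg _) hφ0 h4)
  rw [e5]
  refine (norm_add_le _ _).trans (add_le_add ((norm_sub_le _ _).trans (add_le_add ?_ ?_)) ?_)
  · simp
  · rw [norm_mul, norm_mul, Complex.norm_ofNat]
    gcongr
  · rw [norm_div, Complex.norm_ofNat]
    gcongr

/-! ### Sharpness. -/

/-- The functions `z / (1 - c z) ^ 2`, `|c| = 1`, belong to `𝒰` and are extremal. -/
theorem koebe_extremal {c : ℂ} (hc : ‖c‖ = 1) {f : ℂ → ℂ} (hf : ∀ z, f z = z / (1 - c * z) ^ 2) :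
    f ∈ classU ∧ ‖taylorCoeff f 2 ^ 2 - taylorCoeff f 3‖ = 1 ∧
      ‖taylorCoeff f 3 ^ 2 - taylorCoeff f 5‖ = 4 := by
  have hn : ∀ z ∈ ball (0 : ℂ) 1, 1 - c * z ≠ 0 := by
    intro z hz h
    have h1 : ‖c * z‖ = 1 := by rw [← sub_eq_zero.1 h, norm_one]
    rw [norm_mul, hc, one_mul] at h1
    simp [h1] at hz
  obtain rfl : f = fun z => z / (1 - c * z) ^ 2 := funext hf
  have hl : DifferentiableOn ℂ (fun z => 1 - c * z) (ball 0 1) := by fun_prop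
  have hq : DifferentiableOn ℂ (fun z => ((1 - c * z) * (1 - c * z))⁻¹) (ball 0 1) :=
    (hl.fun_mul hl).fun_inv fun z hz => mul_ne_zero (hn z hz) (hn z hz)
  have hu : DifferentiableOn ℂ (fun z => (1 - c * z) * ((1 - c * z) * (1 - c * z))⁻¹) (ball 0 1) :=
    hl.fun_mul hq
  have hfd : DifferentiableOn ℂ (fun z => z / (1 - c * z) ^ 2) (ball 0 1) :=
    differentiable_fun_id.differentiableOn.fun_div (hl.fun_pow 2) fun z hz => pow_ne_zero 2 (hn z hz)
  have hT : ∀ n, taylorCoeff (fun z => z / (1 - c * z) ^ 2) (n + 1)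
      = taylorCoeff (fun z => ((1 - c * z) * (1 - c * z))⁻¹) n := fun n => by
    rw [← taylorCoeff_id_mul_succ hq]
    exact taylorCoeff_congr (fun z _ => by simp only [div_eq_mul_inv, sq]) _
  -- Multiplying by 1 - cz gives a first-order recurrence; solving it twice, starting from the
  -- constant 1, yields the coefficients (n + 1)cⁿ.
  have hmul : ∀ {u : ℂ → ℂ}, DifferentiableOn ℂ u (ball 0 1) → ∀ n,
      taylorCoeff (fun z => (1 - c * z) * u z) (n + 1)
        = taylorCoeff u (n + 1) - c * taylorCoeff u n := by
    intro u hu n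
    have hzu : DifferentiableOn ℂ (fun z => z * u z) (ball 0 1) := differentiable_fun_id.differentiableOn.fun_mul hu
    rw [taylorCoeff_congr (g := fun z => u z - c * (z * u z)) (fun z _ => by ring),
      taylorCoeff_sub hu (hzu.const_mul c), taylorCoeff_mul (differentiableOn_const c) hzu,
      Finset.sum_range_succ', Finset.sum_eq_zero, zero_add, Nat.sub_zero, taylorCoeff_zero,
      taylorCoeff_id_mul_succ hu]
    intro i _
    rw [taylorCoeff_const_succ, zero_mul]
  have hone : ∀ n, taylorCoeff
      (fun z => (1 - c * z) * ((1 - c * z) * ((1 - c * z) * (1 - c * z))⁻¹)) (n + 1) = 0 := by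
    intro n
    rw [taylorCoeff_congr (g := fun _ => 1), taylorCoeff_const_succ]
    intro z hz
    have := hn z hz
    field_simp
  have hcoef : ∀ n : ℕ, taylorCoeff (fun z => ((1 - c * z) * (1 - c * z))⁻¹) n = (n + 1) * c ^ n := by
    have hU : ∀ n : ℕ,
        taylorCoeff (fun z => (1 - c * z) * ((1 - c * z) * (1 - c * z))⁻¹) n = c ^ n := by
      intro n
      induction n with
      | zero => simp [taylorCoeff_zero]
      | succ n ih =>
        have h1 := (hmul hu n).symm.trans (hone n)
        rw [ih] at h1
        linear_combination h1
    intro n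
    induction n with
    | zero => simp [taylorCoeff_zero]
    | succ n ih =>
      have h1 := (hmul hq n).symm.trans (hU (n + 1))
      rw [ih] at h1
      push_cast
      linear_combination h1
  refine ⟨⟨⟨hfd.analyticOnNhd isOpen_ball, by simp [taylorCoeff_zero],
    by rw [hT 0, hcoef]; simp⟩, fun z hz h0 => ⟨?_, ?_⟩⟩, ?_, ?_⟩
  · exact div_ne_zero h0 (pow_ne_zero 2 (hn z hz))
  · have hz1 := hn z hz
    have hlz : HasDerivAt (fun z => 1 - c * z) (-c) z := by
      simpa using ((hasDerivAt_id' z).const_mul c).const_sub 1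
    have hd := ((hasDerivAt_id' z).fun_div (hlz.fun_pow 2) (pow_ne_zero 2 hz1)).deriv
    have e : (z / (z / (1 - c * z) ^ 2)) ^ 2 * deriv (fun z => z / (1 - c * z) ^ 2) z - 1
        = -(c * z) ^ 2 := by
      rw [hd]
      simp only [Nat.reduceSub, pow_one, Nat.cast_ofNat]
      field_simp
      ring
    rw [e, norm_neg, norm_pow, norm_mul, hc, one_mul]
    exact pow_lt_one₀ (norm_nonneg z) (by simpa [unitDisc] using hz) two_ne_zero
  · rw [hT 1, hT 2, hcoef, hcoef]
    push_cast
    rw [show (((1 : ℂ) + 1) * c ^ 1) ^ 2 - (2 + 1) * c ^ 2 = c ^ 2 by ring, norm_pow, hc, one_pow]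
  · rw [hT 2, hT 4, hcoef, hcoef]
    push_cast
    rw [show (((2 : ℂ) + 1) * c ^ 2) ^ 2 - (4 + 1) * c ^ 4 = 4 * c ^ 4 by ring, norm_mul, norm_pow,
      hc, one_pow, mul_one, Complex.norm_ofNat]

end UnivalentU

theorem mainTheorem1 :
    (∀ f ∈ UnivalentU.classU,
      ‖UnivalentU.taylorCoeff f 2 ^ 2 - UnivalentU.taylorCoeff f 3‖ ≤ 1 ∧
      ‖UnivalentU.taylorCoeff f 3 ^ 2 - UnivalentU.taylorCoeff f 5‖ ≤ 4) ∧
    (UnivalentU.koebe ∈ UnivalentU.classU ∧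
      ‖UnivalentU.taylorCoeff UnivalentU.koebe 2 ^ 2
        - UnivalentU.taylorCoeff UnivalentU.koebe 3‖ = 1 ∧
      ‖UnivalentU.taylorCoeff UnivalentU.koebe 3 ^ 2
        - UnivalentU.taylorCoeff UnivalentU.koebe 5‖ = 4) ∧
    (∀ θ : ℝ,
      UnivalentU.rotation θ UnivalentU.koebe ∈ UnivalentU.classU ∧
      ‖UnivalentU.taylorCoeff (UnivalentU.rotation θ UnivalentU.koebe) 2 ^ 2
        - UnivalentU.taylorCoeff (UnivalentU.rotation θ UnivalentU.koebe) 3‖ = 1 ∧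
      ‖UnivalentU.taylorCoeff (UnivalentU.rotation θ UnivalentU.koebe) 3 ^ 2
        - UnivalentU.taylorCoeff (UnivalentU.rotation θ UnivalentU.koebe) 5‖ = 4) := by
  refine ⟨fun f hf => UnivalentU.norm_coeff_le_of_mem_classU hf, ?_, fun θ => ?_⟩
  · exact UnivalentU.koebe_extremal (c := 1) norm_one fun z => by simp [UnivalentU.koebe]
  · refine UnivalentU.koebe_extremal (Complex.norm_exp_ofReal_mul_I θ) fun z => ?_
    rw [UnivalentU.rotation, UnivalentU.koebe, Complex.exp_neg]
    have := Complex.exp_ne_zero (θ * Complex.I)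
    field_simp
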